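/- A convex lattice polygon is the convex hull of a finite set of points of $\mathbb{Z}^2$ that is two-dimensional (has non-empty interior). Two convex lattice polygons $P$ and $Q$ are unimodularly equivalent if there are a matrix $A\in\mathbb{Z}^{2\times 2}$ with $\det A=\pm1$ and a vector $b\in\mathbb{Z}^2$ such that $\{Ax+b : x\in P\}=Q$. For real $R>0$ let $\kappa(R)$ be the number of unimodular equivalence classes of convex lattice polygons that contain a polygon lying in the closed disc $B_R\subset\mathbb{R}^2$ of radius $R$ centred at the origin. Theorem. There are absolute constants $c_1,c_2>0$ and $R_0$ such that for every real $R\ge R_0$, $$c_1R^{2/3}\le\log\kappa(R)\le c_2R^{2/3}.$$ -/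

import Mathlib

open scoped Matrix

/-- The Euclidean plane. -/
abbrev Plane : Type := EuclideanSpace ℝ (Fin 2)

/-- The point of the plane with the given integer coordinates. -/
noncomputable def latticePoint (z : Fin 2 → ℤ) : Plane :=
  WithLp.toLp 2 (fun i => (z i : ℝ))

/-- A convex lattice polygon: the convex hull of a finite set of points of `ℤ²` which is
two-dimensional, that is, has non-empty interior. -/
structure LatticePolygon where
  carrier : Set Plane
  isHull : ∃ S : Finset (Fin 2 → ℤ), carrier = convexHull ℝ (latticePoint '' (S : Set (Fin 2 → ℤ)))
  twoDim : (interior carrier).Nonempty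

/-- The unimodular transformation `x ↦ A x + b` of the plane, for an integer matrix `A` that is
invertible over `ℤ` (that is, of determinant `1` or `-1`) and an integer vector `b`. -/
noncomputable def unimodularMap (A : GL (Fin 2) ℤ) (b : Fin 2 → ℤ) (x : Plane) : Plane :=
  WithLp.toLp 2 ((A : Matrix (Fin 2) (Fin 2) ℤ).map (fun n : ℤ => (n : ℝ)) *ᵥ WithLp.ofLp x)
    + latticePoint b

/-- Two convex lattice polygons are unimodularly equivalent if some unimodular transformation
maps the first onto the second. -/
def UnimodularEquiv (P Q : LatticePolygon) : Prop :=
  ∃ (A : GL (Fin 2) ℤ) (b : Fin 2 → ℤ), unimodularMap A b '' P.carrier = Q.carrier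

theorem unimodularMap_one (x : Plane) : unimodularMap 1 0 x = x := by
  ext i
  simp [unimodularMap, latticePoint]

theorem unimodularMap_comp (A B : GL (Fin 2) ℤ) (a b : Fin 2 → ℤ) (x : Plane) :
    unimodularMap B b (unimodularMap A a x)
      = unimodularMap (B * A) ((B : Matrix (Fin 2) (Fin 2) ℤ) *ᵥ a + b) x := by
  ext i
  fin_cases i <;>
  · simp [unimodularMap, latticePoint, Matrix.mul_apply, Fin.sum_univ_two, Matrix.vecHead,
      Matrix.vecTail]
    ring

theorem UnimodularEquiv.equivalence : Equivalence UnimodularEquiv where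
  refl P := ⟨1, 0, by
    rw [show unimodularMap 1 0 = id from funext unimodularMap_one, Set.image_id]⟩
  symm := by
    rintro P Q ⟨A, b, h⟩
    refine ⟨A⁻¹, -(((A⁻¹ : GL (Fin 2) ℤ) : Matrix (Fin 2) (Fin 2) ℤ) *ᵥ b), ?_⟩
    rw [← h, Set.image_image]
    simp only [unimodularMap_comp, inv_mul_cancel, add_neg_cancel, unimodularMap_one,
      Set.image_id']
  trans := by
    rintro P Q T ⟨A, a, h⟩ ⟨B, b, k⟩
    refine ⟨B * A, (B : Matrix (Fin 2) (Fin 2) ℤ) *ᵥ a + b, ?_⟩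
    rw [← k, ← h, Set.image_image]
    simp only [unimodularMap_comp]

/-- Unimodular equivalence as an equivalence relation on convex lattice polygons. -/
def unimodularSetoid : Setoid LatticePolygon :=
  ⟨UnimodularEquiv, UnimodularEquiv.equivalence⟩

/-- `kappa R` is the number of unimodular equivalence classes containing a convex lattice polygon
that lies in the closed disc of radius `R` centred at the origin. -/
noncomputable def kappa (R : ℝ) : ℕ :=
  Set.ncard (Quotient.mk unimodularSetoid ''
    {P : LatticePolygon | P.carrier ⊆ Metric.closedBall (0 : Plane) R})

/-! Upper bound: `kappa R` is at most the number of lattice polygons in the disc. A polygon is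
determined by its lower and upper boundary, and each of these by its starting point and its set of
edge vectors, because convexity forces the edges to be distinct and ordered by slope
(`exists_chain_of_direction`, `LatticePolygon.subset_of_isLeast`). The edges have total length
`O(R)`. Sets of distinct lattice vectors of total length at most `N` behave like partitions into
distinct parts in the plane: a generating function bounds their number by `exp (O(N ^ (2 / 3)))`
(`card_edgeSets_le`).

Lower bound: sum the segments `[-v, v]` over `v ∈ [1, r]²`. For each coprime `u` this zonotope has
an edge parallel to `u`, with midpoint `chainPoint r u`. These points, at least `r² / 4` in number
and of size `O(r³)`, are in convex position, so their subsets span `2 ^ (r² / 4)` distinct polygons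
(`chainPolygon_injective`). All contain a fixed unimodular triangle; an affine map is fixed by the
images of its vertices, so each class contains only polynomially many of these polygons
(`two_pow_card_le_kappa`). Take `r` of order `R ^ (1 / 3)`. -/

/-! ### Coprime pairs have positive density. -/

theorem sum_inv_sq_le {n : ℕ} (hn : 2 ≤ n) :
    ∑ d ∈ Finset.Icc 2 n, (1 / (d : ℝ) ^ 2) ≤ 3 / 4 - 1 / (n : ℝ) := by
  induction n, hn using Nat.le_induction with
  | base => norm_num
  | succ n hn ih =>
    rw [Finset.sum_Icc_succ_top (by omega)]
    have hn0 : (0 : ℝ) < n := by exact_mod_cast (by omega : 0 < n)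
    -- Telescoping; the term `-1 / n` in the bound exists for this induction.
    have h : 1 / ((n + 1 : ℕ) : ℝ) ^ 2 ≤ 1 / (n : ℝ) - 1 / ((n + 1 : ℕ) : ℝ) := by
      push_cast
      rw [div_sub_div _ _ hn0.ne' (by positivity), div_le_div_iff₀ (by positivity) (by positivity)]
      nlinarith
    linarith

/-- The pairs of positive integers that are at most `r`. -/
def pairs (r : ℕ) : Finset (ℕ × ℕ) := Finset.Ioc 0 r ×ˢ Finset.Ioc 0 r

/-- The coprime pairs of positive integers that are at most `r`. -/
def coprimePairs (r : ℕ) : Finset (ℕ × ℕ) := {u ∈ pairs r | u.1.Coprime u.2}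

theorem mem_pairs {r : ℕ} {u : ℕ × ℕ} :
    u ∈ pairs r ↔ (0 < u.1 ∧ u.1 ≤ r) ∧ 0 < u.2 ∧ u.2 ≤ r := by
  simp [pairs]

theorem card_pairs (r : ℕ) : (pairs r).card = r ^ 2 := by
  simp [pairs, sq]

theorem mem_coprimePairs {r : ℕ} {u : ℕ × ℕ} :
    u ∈ coprimePairs r ↔ u ∈ pairs r ∧ u.1.Coprime u.2 := by
  simp [coprimePairs]

/-- A non-coprime pair is divisible by some `d ∈ [2, r]`, and at most `(r / d)²` pairs are divisible
by `d`. In total this excludes at most `3 / 4` of all pairs. -/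
theorem sq_le_four_mul_card_coprimePairs {r : ℕ} (hr : 2 ≤ r) :
    r ^ 2 ≤ 4 * (coprimePairs r).card := by
  have hcover : {u ∈ pairs r | ¬ u.1.Coprime u.2} ⊆ (Finset.Icc 2 r).biUnion (fun d =>
      {a ∈ Finset.Ioc 0 r | d ∣ a} ×ˢ {b ∈ Finset.Ioc 0 r | d ∣ b}) := by
    intro u hu
    simp only [Finset.mem_filter, mem_pairs] at hu
    obtain ⟨⟨⟨h1, h2⟩, h3, h4⟩, hc⟩ := hu
    simp only [Finset.mem_biUnion, Finset.mem_product, Finset.mem_filter, Finset.mem_Ioc,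
      Finset.mem_Icc]
    refine ⟨u.1.gcd u.2, ⟨?_, (Nat.gcd_le_left _ h1).trans h2⟩, ⟨⟨h1, h2⟩, Nat.gcd_dvd_left _ _⟩,
      ⟨h3, h4⟩, Nat.gcd_dvd_right _ _⟩
    have : 0 < u.1.gcd u.2 := Nat.gcd_pos_of_pos_left _ h1
    have : u.1.gcd u.2 ≠ 1 := hc
    omega
  have hcard : ({u ∈ pairs r | ¬ u.1.Coprime u.2}.card : ℝ)
      ≤ ∑ d ∈ Finset.Icc 2 r, (r : ℝ) ^ 2 * (1 / (d : ℝ) ^ 2) := by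
    have h := (Finset.card_le_card hcover).trans Finset.card_biUnion_le
    simp only [Finset.card_product, Nat.Ioc_filter_dvd_card_eq_div] at h
    calc ({u ∈ pairs r | ¬ u.1.Coprime u.2}.card : ℝ)
        ≤ ((∑ d ∈ Finset.Icc 2 r, r / d * (r / d) : ℕ) : ℝ) := by exact_mod_cast h
      _ = ∑ d ∈ Finset.Icc 2 r, ((r / d : ℕ) : ℝ) * ((r / d : ℕ) : ℝ) := by push_cast; rfl
      _ ≤ _ := by
        refine Finset.sum_le_sum fun d _ => ?_
        have h1 : ((r / d : ℕ) : ℝ) ≤ r / d := Nat.cast_div_le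
        calc _ ≤ (r / d : ℝ) * (r / d) := by gcongr
          _ = _ := by ring
  rw [← Finset.mul_sum] at hcard
  have h2 := sum_inv_sq_le hr
  have h3 : (coprimePairs r).card + {u ∈ pairs r | ¬ u.1.Coprime u.2}.card = r ^ 2 := by
    rw [← card_pairs r, coprimePairs, Finset.card_filter_add_card_filter_not]
  have h3' : ((coprimePairs r).card : ℝ) + {u ∈ pairs r | ¬ u.1.Coprime u.2}.card
      = (r : ℝ) ^ 2 := by exact_mod_cast h3
  have h4 : (0 : ℝ) ≤ 1 / r := by positivity
  have h5 : (r : ℝ) ^ 2 * ∑ d ∈ Finset.Icc 2 r, (1 / (d : ℝ) ^ 2) ≤ r ^ 2 * (3 / 4) := by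
    gcongr
    linarith
  have : (r : ℝ) ^ 2 ≤ 4 * (coprimePairs r).card := by linarith
  exact_mod_cast this

/-! ### Lattice points in convex position. -/

/-- The linear form whose kernel is spanned by `u`. -/
def crossForm (u : ℕ × ℕ) (z : Fin 2 → ℤ) : ℤ := u.2 * z 0 - u.1 * z 1

/-- The integer vector with the given coordinates. -/
def pairVec (v : ℕ × ℕ) : Fin 2 → ℤ := ![(v.1 : ℤ), (v.2 : ℤ)]

/-- A lattice point on which `crossForm u` is large: the vectors `v ∈ [1, r]²` on one side of the
line through `u` are summed and those on the other side are subtracted. -/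
def chainPoint (r : ℕ) (u : ℕ × ℕ) : Fin 2 → ℤ :=
  ∑ v ∈ pairs r, (crossForm u (pairVec v)).sign • pairVec v

theorem crossForm_chainPoint (r : ℕ) (u w : ℕ × ℕ) :
    crossForm u (chainPoint r w)
      = ∑ v ∈ pairs r, (crossForm w (pairVec v)).sign * crossForm u (pairVec v) := by
  simp only [chainPoint, crossForm, Finset.sum_apply, Pi.smul_apply, smul_eq_mul, Finset.mul_sum,
    ← Finset.sum_sub_distrib]
  exact Finset.sum_congr rfl fun v _ => by ring

theorem crossForm_pairVec_ne_zero {u w : ℕ × ℕ} (hu : u.1.Coprime u.2) (hw : w.1.Coprime w.2)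
    (hne : u ≠ w) : crossForm u (pairVec w) ≠ 0 := by
  intro h
  simp only [crossForm, pairVec, Matrix.cons_val_zero, Matrix.cons_val_one] at h
  have h' : u.2 * w.1 = u.1 * w.2 := by exact_mod_cast sub_eq_zero.mp h
  refine hne (Prod.ext (Nat.dvd_antisymm ?_ ?_) (Nat.dvd_antisymm ?_ ?_))
  · exact hu.dvd_of_dvd_mul_left (h' ▸ Dvd.intro _ rfl)
  · exact hw.dvd_of_dvd_mul_right (h' ▸ Dvd.intro_left _ rfl)
  · exact hu.symm.dvd_of_dvd_mul_left (h' ▸ Dvd.intro _ rfl)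
  · exact hw.symm.dvd_of_dvd_mul_right (h' ▸ Dvd.intro_left _ rfl)

theorem sign_mul_le_sign_mul_self (s x : ℤ) : s.sign * x ≤ x.sign * x := by
  rw [Int.sign_mul_self_eq_abs]
  rcases lt_trichotomy s 0 with h | h | h
  · rw [Int.sign_eq_neg_one_of_neg h]; simpa using neg_le_abs x
  · simp [h]
  · rw [Int.sign_eq_one_of_pos h]; simpa using le_abs_self x

/-- The signs defining `chainPoint r u` maximise `crossForm u` term by term. The term `v = w` makes
this strict: it has sign `0` in `chainPoint r w`, but contributes a positive amount in `chainPoint r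
u`. -/
theorem crossForm_chainPoint_lt {r : ℕ} {u w : ℕ × ℕ} (hu : u ∈ coprimePairs r)
    (hw : w ∈ coprimePairs r) (hne : w ≠ u) :
    crossForm u (chainPoint r w) < crossForm u (chainPoint r u) := by
  rw [mem_coprimePairs] at hu hw
  rw [crossForm_chainPoint, crossForm_chainPoint]
  refine Finset.sum_lt_sum (fun v _ => sign_mul_le_sign_mul_self _ _) ⟨w, hw.1, ?_⟩
  have h0 : crossForm w (pairVec w) = 0 := by
    simp only [crossForm, pairVec, Matrix.cons_val_zero, Matrix.cons_val_one]; ring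
  rw [h0, Int.sign_zero, zero_mul, Int.sign_mul_self_eq_abs]
  exact abs_pos.mpr (crossForm_pairVec_ne_zero hu.2 hw.2 hne.symm)

theorem crossForm_chainPoint_pos {r : ℕ} (hr : 2 ≤ r) {u : ℕ × ℕ} (hu : u ∈ pairs r) :
    0 < crossForm u (chainPoint r u) := by
  rw [crossForm_chainPoint]
  simp only [Int.sign_mul_self_eq_abs]
  have hu1 := (mem_pairs.mp hu).1.1
  -- `(1, 1)` and `(1, 2)` cannot both be parallel to `u`.
  have hpos : ∃ v ∈ pairs r, 0 < |crossForm u (pairVec v)| := by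
    by_contra! h
    have h1 := h (1, 1) (mem_pairs.mpr (by simp; omega))
    have h2 := h (1, 2) (mem_pairs.mpr (by simp; omega))
    rw [abs_nonpos_iff] at h1 h2
    simp [crossForm, pairVec] at h1 h2
    omega
  exact Finset.sum_pos' (fun v _ => abs_nonneg _) hpos

theorem abs_chainPoint_le (r : ℕ) (u : ℕ × ℕ) (i : Fin 2) : |chainPoint r u i| ≤ (r : ℤ) ^ 3 := by
  rw [chainPoint, Finset.sum_apply]
  refine (Finset.abs_sum_le_sum_abs _ _).trans ?_
  have h : ∀ v ∈ pairs r, |((crossForm u (pairVec v)).sign • pairVec v) i| ≤ (r : ℤ) := by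
    intro v hv
    rw [mem_pairs] at hv
    rw [Pi.smul_apply, smul_eq_mul, abs_mul]
    have h1 : |(crossForm u (pairVec v)).sign| ≤ 1 := by
      rcases Int.sign_trichotomy (crossForm u (pairVec v)) with h | h | h <;> simp [h]
    have h2 : |pairVec v i| ≤ r := by
      fin_cases i <;> simp [pairVec] <;> omega
    calc _ ≤ 1 * (r : ℤ) := mul_le_mul h1 h2 (abs_nonneg _) zero_le_one
      _ = r := one_mul _
  calc _ ≤ (pairs r).card • (r : ℤ) := Finset.sum_le_card_nsmul _ _ _ h
    _ = (r : ℤ) ^ 3 := by rw [card_pairs, nsmul_eq_mul]; push_cast; ring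

/-! ### The lower boundary as a chain of edges. -/

/-- The value of the lower support function in direction `t` of a polygonal chain that starts at
`p` and has edge vectors `E`. -/
noncomputable def chainValue (p : ℤ × ℤ) (E : Finset (ℤ × ℤ)) (t : ℝ) : ℝ :=
  p.2 - t * p.1 - ∑ e ∈ E, max (t * e.1 - e.2) 0

/-- The values of `(x, y) ↦ y - t x` on a set of lattice points. -/
def tiltValues (V : Finset (ℤ × ℤ)) (t : ℝ) : Set ℝ :=
  (fun v : ℤ × ℤ => (v.2 : ℝ) - t * v.1) '' V

/-- One step of gift wrapping: `q` is the rightmost point of minimal slope seen from `p`. Taking the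
rightmost one makes the next slope strictly larger. -/
theorem exists_first_edge {V : Finset (ℤ × ℤ)} {p : ℤ × ℤ} (hV : ∃ v ∈ V, v ≠ p)
    (h : ∀ v ∈ V, v ≠ p → p.1 < v.1) :
    ∃ q ∈ V, q ≠ p ∧ ∀ v ∈ V, v ≠ p →
      0 ≤ (q.1 - p.1) * (v.2 - p.2) - (q.2 - p.2) * (v.1 - p.1) ∧
      (q.1 < v.1 → 0 < (q.1 - p.1) * (v.2 - p.2) - (q.2 - p.2) * (v.1 - p.1)) := by
  obtain ⟨v₀, hv₀, hv₀p⟩ := hV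
  set slope : ℤ × ℤ → ℚ := fun v => ((v.2 - p.2 : ℤ) : ℚ) / ((v.1 - p.1 : ℤ) : ℚ) with hslope
  obtain ⟨m, hm, hmin⟩ := Finset.exists_min_image {v ∈ V | v ≠ p} slope
    ⟨v₀, Finset.mem_filter.mpr ⟨hv₀, hv₀p⟩⟩
  obtain ⟨q, hq, hmax⟩ := Finset.exists_max_image {v ∈ V | v ≠ p ∧ slope v = slope m} (fun v => v.1)
    ⟨m, by simpa using hm⟩
  simp only [Finset.mem_filter] at hm hmin hq hmax
  refine ⟨q, hq.1, hq.2.1, fun v hv hvp => ?_⟩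
  have hqp : (0 : ℚ) < ((q.1 - p.1 : ℤ) : ℚ) := by
    exact_mod_cast sub_pos.mpr (h q hq.1 hq.2.1)
  have hvp' : (0 : ℚ) < ((v.1 - p.1 : ℤ) : ℚ) := by
    exact_mod_cast sub_pos.mpr (h v hv hvp)
  have hle : slope q ≤ slope v := hq.2.2 ▸ hmin v ⟨hv, hvp⟩
  have h1 : (q.2 - p.2) * (v.1 - p.1) ≤ (v.2 - p.2) * (q.1 - p.1) := by
    have := (div_le_div_iff₀ hqp hvp').mp hle
    exact_mod_cast this
  refine ⟨by linarith, fun hlt => ?_⟩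
  have hne : slope q ≠ slope v := by
    intro heq
    exact absurd (hmax v ⟨hv, hvp, heq ▸ hq.2.2⟩) (not_le.mpr hlt)
  have h2 : (q.2 - p.2) * (v.1 - p.1) ≠ (v.2 - p.2) * (q.1 - p.1) := by
    intro heq
    refine hne ((div_eq_div_iff hqp.ne' hvp'.ne').mpr ?_)
    exact_mod_cast heq
  have := lt_of_le_of_ne h1 h2
  linarith

/-- Gift wrapping by induction, with `d` the direction of the preceding edge. Requiring every later
edge to turn strictly left of `d` keeps the edge vectors distinct, so that a set can record them. -/
theorem exists_chain_of_direction (n : ℕ) : ∀ (V : Finset (ℤ × ℤ)) (p d : ℤ × ℤ), V.card = n →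
    0 ≤ d.1 → p ∈ V →
    (∀ v ∈ V, v ≠ p → p.1 < v.1 ∧ 0 < d.1 * (v.2 - p.2) - d.2 * (v.1 - p.1)) →
    ∃ E : Finset (ℤ × ℤ), (∀ e ∈ E, 0 < e.1 ∧ 0 < d.1 * e.2 - d.2 * e.1) ∧
      p + ∑ e ∈ E, e ∈ V ∧ ∀ t : ℝ, IsLeast (tiltValues V t) (chainValue p E t) := by
  induction n using Nat.strong_induction_on with
  | _ n ih =>
  intro V p d hn hd hp h
  by_cases hV : ∃ v ∈ V, v ≠ p
  swap
  · push Not at hV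
    refine ⟨∅, by simp, by simpa using hp, fun t => ⟨⟨p, hp, by simp [chainValue]⟩, ?_⟩⟩
    rintro _ ⟨v, hv, rfl⟩
    rw [hV v hv]
    simp [chainValue]
  obtain ⟨q, hq, hqp, hmin⟩ := exists_first_edge hV (fun v hv hvp => (h v hv hvp).1)
  obtain ⟨hpq, hdq⟩ := h q hq hqp
  obtain ⟨a, ha⟩ : ∃ a, a = q.1 - p.1 := ⟨_, rfl⟩
  obtain ⟨b, hb⟩ : ∃ b, b = q.2 - p.2 := ⟨_, rfl⟩
  rw [← ha, ← hb] at hmin hdq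
  have ha0 : 0 < a := by omega
  set V' : Finset (ℤ × ℤ) := {v ∈ V | v = q ∨ q.1 < v.1} with hV'
  have hsub : V' ⊆ V := Finset.filter_subset _ _
  have hpV' : p ∉ V' := by
    simp only [hV', Finset.mem_filter, not_and, not_or, not_lt]
    exact fun _ => ⟨hqp.symm, hpq.le⟩
  have hcard : V'.card < n := hn ▸ Finset.card_lt_card ⟨hsub, fun hh => hpV' (hh hp)⟩
  obtain ⟨E, hE, hEs, hEt⟩ := ih _ hcard V' q (a, b) rfl ha0.le
    (by simp [hV', hq]) (by
      intro v hv hvq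
      simp only [hV', Finset.mem_filter, hvq, false_or] at hv
      have := (hmin v hv.1 (by rintro rfl; omega)).2 hv.2
      refine ⟨hv.2, ?_⟩
      have e : a * (v.2 - q.2) - b * (v.1 - q.1) = a * (v.2 - p.2) - b * (v.1 - p.1) := by
        rw [ha, hb]; ring
      simpa [e] using this)
  simp only at hE
  have hnot : (a, b) ∉ E := fun hh => by
    have := (hE _ hh).2
    simp only at this
    linarith [mul_comm a b]
  refine ⟨insert (a, b) E, ?_, ?_, fun t => ?_⟩
  · intro e he
    rcases Finset.mem_insert.mp he with rfl | he
    · exact ⟨ha0, hdq⟩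
    · obtain ⟨h1, h2⟩ := hE e he
      refine ⟨h1, pos_of_mul_pos_right (a := a) ?_ ha0.le⟩
      -- Turning left is transitive: `e` is left of `(a, b)`, which is left of `d`.
      have : a * (d.1 * e.2 - d.2 * e.1)
          = d.1 * (a * e.2 - b * e.1) + e.1 * (d.1 * b - d.2 * a) := by ring
      rw [this]
      exact add_pos_of_nonneg_of_pos (mul_nonneg hd h2.le) (mul_pos h1 hdq)
  · rw [Finset.sum_insert hnot, ← add_assoc]
    have : p + (a, b) = q := by ext <;> simp [ha, hb]
    rw [this]
    exact hsub hEs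
  have haR : (0 : ℝ) < a := by exact_mod_cast ha0
  have haR' : (a : ℝ) = q.1 - p.1 := by exact_mod_cast ha
  have hbR' : (b : ℝ) = q.2 - p.2 := by exact_mod_cast hb
  have hminR : ∀ v ∈ V, v ≠ p →
      (b : ℝ) * (v.1 - p.1) ≤ a * (v.2 - p.2) := fun v hv hvp => by
    have := sub_nonneg.mp (hmin v hv hvp).1
    exact_mod_cast this
  -- If the first slope is at least `t`, so are all later ones and the minimum is at `p`; otherwise
  -- moving to `q` decreases the form.
  rcases le_or_gt (t * a) b with ht | ht
  · have hz : chainValue p (insert (a, b) E) t = p.2 - t * p.1 := by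
      rw [chainValue, Finset.sum_eq_zero, sub_zero]
      intro e he
      refine max_eq_right ?_
      rcases Finset.mem_insert.mp he with rfl | he
      · simpa using ht
      · obtain ⟨h1, h2⟩ := hE e he
        have h1R : (0 : ℝ) < e.1 := by exact_mod_cast h1
        have h2R : (b : ℝ) * e.1 < a * e.2 := by exact_mod_cast sub_pos.mp h2
        have h3 : t * a * e.1 ≤ b * e.1 := by gcongr
        have : a * (t * e.1) ≤ a * (e.2 : ℝ) := by linarith
        linarith [le_of_mul_le_mul_left this haR]
    rw [hz]
    refine ⟨⟨p, hp, rfl⟩, ?_⟩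
    rintro _ ⟨v, hv, rfl⟩
    by_cases hvp : v = p
    · rw [hvp]
    have h1 : (0 : ℝ) < v.1 - p.1 := by
      have := sub_pos.mpr (h v hv hvp).1
      exact_mod_cast this
    have h3 : t * a * ((v.1 : ℝ) - p.1) ≤ b * (v.1 - p.1) := by gcongr
    have : a * (t * ((v.1 : ℝ) - p.1)) ≤ a * ((v.2 : ℝ) - p.2) := by
      linarith [hminR v hv hvp]
    have := le_of_mul_le_mul_left this haR
    simp only
    linarith
  · have hz : chainValue p (insert (a, b) E) t = chainValue q E t := by
      rw [chainValue, Finset.sum_insert hnot, chainValue, max_eq_left (by simp; linarith), haR',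
        hbR']
      ring
    rw [hz]
    obtain ⟨⟨w, hw, hwt⟩, hlow⟩ := hEt t
    refine ⟨⟨w, hsub hw, hwt⟩, ?_⟩
    have hqle : chainValue q E t ≤ q.2 - t * q.1 := hlow ⟨q, by simp [hV', hq], rfl⟩
    rintro _ ⟨v, hv, rfl⟩
    by_cases hvp : v = p
    · rw [hvp]
      simp only
      rw [haR', hbR'] at ht
      linarith
    by_cases hvV' : v ∈ V'
    · exact hlow ⟨v, hvV', rfl⟩
    simp only [hV', Finset.mem_filter, not_and, not_or, not_lt] at hvV'
    have h1 : (v.1 : ℝ) - q.1 ≤ 0 := by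
      have := sub_nonpos.mpr (hvV' hv).2
      exact_mod_cast this
    -- A discarded point is not to the right of `q` and not below the line `pq`, whose slope is less
    -- than `t`; so it does not beat `q`.
    have h3 : t * a * ((v.1 : ℝ) - q.1) ≤ b * (v.1 - q.1) :=
      mul_le_mul_of_nonpos_right ht.le h1
    have h4 : (b : ℝ) * (v.1 - q.1) ≤ a * (v.2 - q.2) := by
      have e : (a : ℝ) * (v.2 - q.2) - b * (v.1 - q.1) = a * (v.2 - p.2) - b * (v.1 - p.1) := by
        rw [haR', hbR']; ring
      linarith [hminR v hv hvp]
    have : a * (t * ((v.1 : ℝ) - q.1)) ≤ a * ((v.2 : ℝ) - q.2) := by linarith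
    have := le_of_mul_le_mul_left this haR
    simp only
    linarith

/-- The lower boundary of a finite set of lattice points is a chain with distinct edge vectors. -/
theorem exists_lower_chain {V : Finset (ℤ × ℤ)} (hV : V.Nonempty) :
    ∃ p ∈ V, ∃ E : Finset (ℤ × ℤ), (∀ e ∈ E, 0 < e.1) ∧ p + ∑ e ∈ E, e ∈ V ∧
      ∀ t : ℝ, IsLeast (tiltValues V t) (chainValue p E t) := by
  obtain ⟨m, hm, hmmin⟩ := V.exists_min_image (fun v => v.1) hV
  obtain ⟨p, hp, hpmin⟩ := Finset.exists_min_image {v ∈ V | v.1 = m.1} (fun v => v.2)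
    ⟨m, by simp [hm]⟩
  simp only [Finset.mem_filter] at hp hpmin
  set V' : Finset (ℤ × ℤ) := {v ∈ V | v = p ∨ p.1 < v.1} with hV'
  have hsub : V' ⊆ V := Finset.filter_subset _ _
  have hpV' : p ∈ V' := by simp [hV', hp.1]
  -- Start at the lowest leftmost point, coming vertically downwards: left of `(0, -1)` means to the
  -- right of `p`.
  obtain ⟨E, hE, hEs, hEt⟩ := exists_chain_of_direction _ V' p (0, -1) rfl le_rfl hpV' (by
    intro v hv hvp
    simp only [hV', Finset.mem_filter, hvp, false_or] at hv
    refine ⟨hv.2, ?_⟩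
    simp only
    linarith [hv.2])
  refine ⟨p, hp.1, E, fun e he => (hE e he).1, hsub hEs, fun t => ?_⟩
  obtain ⟨⟨w, hw, hwt⟩, hlow⟩ := hEt t
  refine ⟨⟨w, hsub hw, hwt⟩, ?_⟩
  rintro _ ⟨v, hv, rfl⟩
  by_cases hvV' : v ∈ V'
  · exact hlow ⟨v, hvV', rfl⟩
  simp only [hV', Finset.mem_filter, not_and, not_or, not_lt] at hvV'
  have h1 : v.1 = p.1 := le_antisymm (hvV' hv).2 (hp.2 ▸ hmmin v hv)
  have h2 : (p.2 : ℝ) ≤ v.2 := by exact_mod_cast hpmin v ⟨hv, h1.trans hp.2⟩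
  have h3 : chainValue p E t ≤ p.2 - t * p.1 := hlow ⟨p, hpV', rfl⟩
  simp only
  rw [h1]
  linarith

/-! ### Counting the possible edge sets. -/

/-- The length, in the `ℓ¹` norm, of a chain with given edge vectors. -/
def chainLength (E : Finset (ℤ × ℤ)) : ℤ := ∑ e ∈ E, (e.1 + |e.2|)

/-- Write `|y| = y + 2 max (-y) 0`. The two coordinate sums are at most `2 m` each, and the total
descent, read off from the minimum at `t = 0`, is at most `2 m`. -/
theorem chainLength_le {V E : Finset (ℤ × ℤ)} {p : ℤ × ℤ} {m : ℤ} (hp : p ∈ V)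
    (hE : p + ∑ e ∈ E, e ∈ V) (ht : IsLeast (tiltValues V 0) (chainValue p E 0))
    (hm : ∀ v ∈ V, |v.1| ≤ m ∧ |v.2| ≤ m) : chainLength E ≤ 8 * m := by
  obtain ⟨⟨w, hw, hwt⟩, -⟩ := ht
  have h1 : ∑ e ∈ E, max (-e.2) 0 = p.2 - w.2 := by
    have : (w.2 : ℝ) = p.2 - ∑ e ∈ E, max (-(e.2 : ℝ)) 0 := by simpa [chainValue] using hwt
    have : ∑ e ∈ E, max (-(e.2 : ℝ)) 0 = p.2 - w.2 := by linarith
    exact_mod_cast this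
  have h2 : chainLength E = ∑ e ∈ E, e.1 + (∑ e ∈ E, e.2 + 2 * ∑ e ∈ E, max (-e.2) 0) := by
    rw [chainLength, Finset.mul_sum, ← Finset.sum_add_distrib, ← Finset.sum_add_distrib]
    refine Finset.sum_congr rfl fun e _ => ?_
    rcases le_total 0 e.2 with h | h
    · rw [abs_of_nonneg h, max_eq_right (by omega)]; ring
    · rw [abs_of_nonpos h, max_eq_left (by omega)]; ring
  have h3 := hm _ hp
  have h4 := hm _ hE
  have h5 := hm _ hw
  simp only [Prod.fst_add, Prod.snd_add, Prod.fst_sum, Prod.snd_sum, abs_le] at h3 h4 h5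
  omega

theorem sum_range_pow_le {x : ℝ} (hx0 : 0 ≤ x) (hx1 : x < 1) (N : ℕ) :
    ∑ k ∈ Finset.range N, x ^ k ≤ 1 / (1 - x) := by
  rw [one_div, ← tsum_geometric_of_lt_one hx0 hx1]
  exact (summable_geometric_of_lt_one hx0 hx1).sum_le_tsum _ (fun _ _ => by positivity)

theorem sum_pow_natAbs_le {x : ℝ} (hx0 : 0 ≤ x) (hx1 : x < 1) (N : ℕ) :
    ∑ b ∈ Finset.Icc (-N : ℤ) N, x ^ b.natAbs ≤ 2 / (1 - x) := by
  have hsub : Finset.Icc (-N : ℤ) N ⊆ (Finset.range (N + 1)).image (fun k : ℕ => (k : ℤ)) ∪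
      (Finset.range (N + 1)).image (fun k : ℕ => -(k : ℤ)) := by
    intro b hb
    rw [Finset.mem_Icc] at hb
    simp only [Finset.mem_union, Finset.mem_image, Finset.mem_range]
    rcases le_total 0 b with h | h
    · exact Or.inl ⟨b.natAbs, by omega, by omega⟩
    · exact Or.inr ⟨b.natAbs, by omega, by omega⟩
  have hn : ∀ b : ℤ, 0 ≤ x ^ b.natAbs := fun b => by positivity
  refine (Finset.sum_le_sum_of_subset_of_nonneg hsub fun b _ _ => hn b).trans ?_
  refine (le_add_of_nonneg_right (Finset.sum_nonneg fun b _ => hn b)).trans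
    (Finset.sum_union_inter.trans_le ?_)
  rw [Finset.sum_image (by simp), Finset.sum_image (by simp)]
  simp only [Int.natAbs_neg, Int.natAbs_natCast]
  have := sum_range_pow_le hx0 hx1 (N + 1)
  rw [show 2 / (1 - x) = 1 / (1 - x) + 1 / (1 - x) by ring]
  linarith

/-- The sets of edge vectors pointing to the right whose total length is at most `N`. -/
noncomputable def edgeSets (N : ℕ) : Finset (Finset (ℤ × ℤ)) :=
  {E ∈ (Finset.Icc (0 : ℤ) N ×ˢ Finset.Icc (-N : ℤ) N).powerset | chainLength E ≤ N}

theorem mem_edgeSets {N : ℕ} {E : Finset (ℤ × ℤ)} (hE : ∀ e ∈ E, 0 < e.1)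
    (hN : chainLength E ≤ N) : E ∈ edgeSets N := by
  simp only [edgeSets, Finset.mem_filter, Finset.mem_powerset]
  refine ⟨fun e he => ?_, hN⟩
  have h := (Finset.single_le_sum (f := fun e : ℤ × ℤ => e.1 + |e.2|)
    (fun e he => add_nonneg (hE e he).le (abs_nonneg _)) he).trans hN
  have h1 := hE e he
  have h2 := abs_nonneg e.2
  have h3 := abs_le.mp (show |e.2| ≤ N by linarith)
  simp only [Finset.mem_product, Finset.mem_Icc]
  exact ⟨⟨h1.le, by linarith⟩, h3⟩

/-- Weight each set by `x` to the power of its length, `x = exp (-δ)`. Summed over all subsets of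
the box the weight is a product of factors `1 + x ^ k ≤ exp (x ^ k)`, and the exponents form a
double geometric series. -/
theorem card_edgeSets_le_of_pos (N : ℕ) {δ : ℝ} (hδ : 0 < δ) :
    ((edgeSets N).card : ℝ) ≤ Real.exp (δ * N + 2 / (1 - Real.exp (-δ)) ^ 2) := by
  set x := Real.exp (-δ) with hx
  have hx0 : 0 ≤ x := (Real.exp_pos _).le
  have hx1 : x < 1 := by rw [hx, Real.exp_lt_one_iff]; linarith
  set B := Finset.Icc (0 : ℤ) N ×ˢ Finset.Icc (-N : ℤ) N with hB
  have hw : ∀ E ∈ edgeSets N,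
      (1 : ℝ) ≤ Real.exp (δ * N) * ∏ e ∈ E, x ^ (e.1.natAbs + e.2.natAbs) := by
    intro E hE
    simp only [edgeSets, Finset.mem_filter, Finset.mem_powerset] at hE
    have hlen : (∑ e ∈ E, (e.1.natAbs + e.2.natAbs) : ℕ) ≤ N := by
      zify
      refine le_trans (le_of_eq (Finset.sum_congr rfl fun e he => ?_)) hE.2
      have := hE.1 he
      simp only [Finset.mem_product, Finset.mem_Icc] at this
      rw [abs_of_nonneg this.1.1]
    rw [Finset.prod_pow_eq_pow_sum, hx, ← Real.exp_nat_mul, ← Real.exp_add]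
    rw [Real.one_le_exp_iff]
    have : ((∑ e ∈ E, (e.1.natAbs + e.2.natAbs) : ℕ) : ℝ) ≤ N := by exact_mod_cast hlen
    nlinarith
  calc ((edgeSets N).card : ℝ) = ∑ E ∈ edgeSets N, (1 : ℝ) := by simp
    _ ≤ ∑ E ∈ edgeSets N, Real.exp (δ * N) * ∏ e ∈ E, x ^ (e.1.natAbs + e.2.natAbs) :=
        Finset.sum_le_sum hw
    _ ≤ ∑ E ∈ B.powerset, Real.exp (δ * N) * ∏ e ∈ E, x ^ (e.1.natAbs + e.2.natAbs) :=
        Finset.sum_le_sum_of_subset_of_nonneg (Finset.filter_subset _ _)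
          fun E _ _ => by positivity
    _ = Real.exp (δ * N) * ∏ e ∈ B, (1 + x ^ (e.1.natAbs + e.2.natAbs)) := by
        rw [← Finset.mul_sum, Finset.prod_one_add]
    _ ≤ Real.exp (δ * N) * ∏ e ∈ B, Real.exp (x ^ (e.1.natAbs + e.2.natAbs)) := by
        gcongr with e _
        rw [add_comm]
        exact Real.add_one_le_exp _
    _ = Real.exp (δ * N + ∑ e ∈ B, x ^ (e.1.natAbs + e.2.natAbs)) := by
        rw [← Real.exp_sum, Real.exp_add]
    _ ≤ _ := by
        gcongr
        simp only [pow_add]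
        rw [hB, Finset.sum_product]
        simp only [← Finset.mul_sum]
        rw [← Finset.sum_mul, show 2 / (1 - x) ^ 2 = 1 / (1 - x) * (2 / (1 - x)) by
          rw [div_mul_div_comm, one_mul, sq]]
        have ha : ∑ a ∈ Finset.Icc (0 : ℤ) N, x ^ a.natAbs ≤ 1 / (1 - x) := by
          refine le_trans (le_of_eq ?_) (sum_range_pow_le hx0 hx1 (N + 1))
          refine (Finset.sum_nbij (fun k : ℕ => (k : ℤ)) ?_ ?_ ?_ ?_).symm
          · intro k hk
            simp only [Finset.mem_range, Finset.mem_Icc] at hk ⊢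
            omega
          · exact fun _ _ _ _ h => by simpa using h
          · intro a ha
            simp only [Finset.coe_Icc, Set.mem_Icc] at ha
            exact ⟨a.natAbs, by simp only [Finset.coe_range, Set.mem_Iio]; omega, by simp [ha.1]⟩
          · simp
        have hx1' : 0 < 1 - x := sub_pos.mpr hx1
        exact mul_le_mul ha (sum_pow_natAbs_le hx0 hx1 N)
          (Finset.sum_nonneg fun b _ => by positivity) (by positivity)

theorem card_edgeSets_le {N : ℕ} (hN : 1 ≤ N) :
    ((edgeSets N).card : ℝ) ≤ Real.exp (9 * (N : ℝ) ^ (2 / 3 : ℝ)) := by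
  have hN0 : (0 : ℝ) < N := by exact_mod_cast hN
  -- This choice balances `δ N` against `8 / δ²`.
  set δ : ℝ := (N : ℝ) ^ (-(1 / 3) : ℝ) with hδ
  have hδ0 : 0 < δ := Real.rpow_pos_of_pos hN0 _
  have hδ1 : δ ≤ 1 := Real.rpow_le_one_of_one_le_of_nonpos (by exact_mod_cast hN) (by norm_num)
  refine (card_edgeSets_le_of_pos N hδ0).trans (Real.exp_le_exp.mpr ?_)
  have h1 : δ * N = (N : ℝ) ^ (2 / 3 : ℝ) := by
    rw [hδ, ← Real.rpow_add_one hN0.ne']; norm_num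
  have h2 : δ / 2 ≤ 1 - Real.exp (-δ) := by
    have : Real.exp (-δ) ≤ 1 - δ / 2 := by
      rw [Real.exp_neg, inv_le_comm₀ (Real.exp_pos _) (by linarith)]
      refine le_trans ?_ (Real.add_one_le_exp δ)
      rw [inv_le_iff_one_le_mul₀ (by linarith)]
      nlinarith
    linarith
  have h3 : 2 / (1 - Real.exp (-δ)) ^ 2 ≤ 2 / (δ / 2) ^ 2 := by gcongr
  have h4 : 2 / (δ / 2) ^ 2 = 8 * (N : ℝ) ^ (2 / 3 : ℝ) := by
    have : δ ^ 2 = ((N : ℝ) ^ (2 / 3 : ℝ))⁻¹ := by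
      rw [hδ, ← Real.rpow_natCast, ← Real.rpow_mul hN0.le, ← Real.rpow_neg hN0.le]; norm_num
    rw [div_pow, this]
    field_simp
    norm_num
  linarith

/-! ### Polygons are determined by their two chains. -/

theorem LatticePolygon.ext_carrier {P Q : LatticePolygon} (h : P.carrier = Q.carrier) : P = Q := by
  cases P; cases Q; simpa using h

theorem LatticePolygon.isCompact (P : LatticePolygon) : IsCompact P.carrier := by
  obtain ⟨S, hS⟩ := P.isHull
  rw [hS]
  exact (S.finite_toSet.image latticePoint).isCompact_convexHull ℝ

theorem LatticePolygon.convex (P : LatticePolygon) : Convex ℝ P.carrier := by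
  obtain ⟨S, hS⟩ := P.isHull
  rw [hS]
  exact convex_convexHull ℝ _

theorem abs_coord_le_norm (x : Plane) (i : Fin 2) : |x i| ≤ ‖x‖ := by
  simpa using PiLp.norm_apply_le x i

/-- The linear form `(x, y) ↦ s y - t x` on the plane. -/
noncomputable def tiltForm (s t : ℝ) : Plane →ₗ[ℝ] ℝ where
  toFun x := s * x 1 - t * x 0
  map_add' x y := by simp; ring
  map_smul' c x := by simp; ring

theorem tiltForm_apply (s t : ℝ) (x : Plane) : tiltForm s t x = s * x 1 - t * x 0 := rfl

theorem isLeast_image_convexHull {X : Set Plane} {f : Plane →ₗ[ℝ] ℝ} {c : ℝ}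
    (h : IsLeast (f '' X) c) : IsLeast (f '' convexHull ℝ X) c := by
  obtain ⟨⟨x, hx, hxc⟩, hlow⟩ := h
  refine ⟨⟨x, subset_convexHull ℝ X hx, hxc⟩, ?_⟩
  have : convexHull ℝ X ⊆ {y | c ≤ f y} :=
    convexHull_min (fun y hy => hlow ⟨y, hy, rfl⟩) (convex_halfSpace_ge f.isLinear c)
  rintro _ ⟨y, hy, rfl⟩
  exact this hy

/-- The lattice points of the square `[-m, m]²`. -/
noncomputable def latticeBox (m : ℕ) : Finset (ℤ × ℤ) :=
  Finset.Icc (-m : ℤ) m ×ˢ Finset.Icc (-m : ℤ) m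

theorem card_latticeBox (m : ℕ) : (latticeBox m).card = (2 * m + 1) ^ 2 := by
  rw [latticeBox, Finset.card_product, Int.card_Icc, ← sq]
  congr 1
  omega

/-- The sign `s = -1` reflects the polygon, so that its upper boundary becomes a lower chain. -/
theorem LatticePolygon.exists_chain (P : LatticePolygon) {R : ℝ}
    (hP : P.carrier ⊆ Metric.closedBall 0 R) {s : ℤ} (hs : |s| = 1) :
    ∃ D ∈ latticeBox ⌊R⌋₊ ×ˢ edgeSets (8 * ⌊R⌋₊),
      ∀ t : ℝ, IsLeast (tiltForm s t '' P.carrier) (chainValue D.1 D.2 t) := by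
  obtain ⟨S, hS⟩ := P.isHull
  set V : Finset (ℤ × ℤ) := S.image (fun z => (z 0, s * z 1)) with hV
  have hSne : S.Nonempty := by
    have h := P.twoDim.mono interior_subset
    rw [hS, convexHull_nonempty_iff, Set.image_nonempty] at h
    exact h
  obtain ⟨p, hp, E, hE, hpE, hmin⟩ := exists_lower_chain (hSne.image _ : V.Nonempty)
  have hbox : ∀ v ∈ V, |v.1| ≤ (⌊R⌋₊ : ℤ) ∧ |v.2| ≤ (⌊R⌋₊ : ℤ) := by
    intro v hv
    obtain ⟨z, hz, rfl⟩ := Finset.mem_image.mp hv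
    have hzP : latticePoint z ∈ P.carrier := hS ▸ subset_convexHull ℝ _ ⟨z, hz, rfl⟩
    have hnorm : ‖latticePoint z‖ ≤ R := by simpa using hP hzP
    have hi : ∀ i, |z i| ≤ (⌊R⌋₊ : ℤ) := by
      intro i
      have h1 := (abs_coord_le_norm (latticePoint z) i).trans hnorm
      have h2 : ((z i).natAbs : ℝ) ≤ R := by
        rw [Nat.cast_natAbs]
        simpa [latticePoint] using h1
      rw [Int.abs_eq_natAbs]
      exact_mod_cast Nat.le_floor h2
    refine ⟨hi 0, ?_⟩
    simp only [abs_mul, hs, one_mul]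
    exact hi 1
  refine ⟨(p, E), Finset.mem_product.mpr ⟨?_, mem_edgeSets hE ?_⟩, fun t => ?_⟩
  · have := hbox p hp
    rw [abs_le, abs_le] at this
    simpa [latticeBox] using this
  · exact_mod_cast chainLength_le hp hpE (hmin 0) hbox
  · rw [hS]
    refine isLeast_image_convexHull ?_
    convert hmin t using 1
    rw [tiltValues, Finset.coe_image, Set.image_image, Set.image_image]
    refine Set.image_congr' fun z => ?_
    simp [tiltForm_apply, latticePoint]

/-- Chains record only forms with non-zero `y`-coefficient. A separating vertical line can be tilted
slightly, since `K` is bounded. -/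
theorem exists_nonvertical_separation {K : Set Plane} (hK : Convex ℝ K) (hKc : IsCompact K)
    {x : Plane} (hx : x ∉ K) : ∃ a b : ℝ, b ≠ 0 ∧ ∀ y ∈ K, a * x 0 + b * x 1 < a * y 0 + b * y 1 := by
  obtain ⟨f, u, hfx, hfK⟩ := geometric_hahn_banach_point_closed hK hKc.isClosed hx
  obtain ⟨M, hM⟩ := hKc.isBounded.exists_norm_le
  have hf : ∀ y : Plane, f y = f (EuclideanSpace.single 0 1) * y 0
      + f (EuclideanSpace.single 1 1) * y 1 := by
    intro y
    have : y = y 0 • EuclideanSpace.single 0 (1 : ℝ) + y 1 • EuclideanSpace.single 1 (1 : ℝ) := by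
      ext i
      fin_cases i <;> simp
    conv_lhs => rw [this]
    rw [map_add, map_smul, map_smul, smul_eq_mul, smul_eq_mul]
    ring
  obtain ⟨a, ha⟩ : ∃ a, a = f (EuclideanSpace.single 0 1) := ⟨_, rfl⟩
  obtain ⟨b, hb⟩ : ∃ b, b = f (EuclideanSpace.single 1 1) := ⟨_, rfl⟩
  rw [← ha, ← hb] at hf
  by_cases hb0 : b = 0
  swap
  · refine ⟨a, b, hb0, fun y hy => ?_⟩
    rw [← hf, ← hf]
    exact hfx.trans (hfK y hy)
  -- `C` bounds `x 1 - y 1` on `K`, so a tilt of `(u - f x) / C` uses up no more than the gap `u - f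
  -- x`.
  obtain ⟨C, hC⟩ : ∃ C, C = |M| + |x 1| + 1 := ⟨_, rfl⟩
  have hC0 : 0 < C := by rw [hC]; positivity
  refine ⟨a, (u - f x) / C, (div_pos (sub_pos.mpr hfx) hC0).ne', fun y hy => ?_⟩
  have h1 := hfK y hy
  have h2 : |y 1| ≤ |M| := (abs_coord_le_norm y 1).trans ((hM y hy).trans (le_abs_self M))
  have h3 : x 1 - y 1 ≤ C := by
    rw [hC]
    linarith [le_abs_self (x 1), neg_abs_le (y 1)]
  have h4 : (u - f x) / C * (x 1 - y 1) ≤ u - f x := by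
    calc _ ≤ (u - f x) / C * C := by
          gcongr
      _ = u - f x := div_mul_cancel₀ _ hC0.ne'
  have h5 := hf x
  have h6 := hf y
  rw [hb0] at h5 h6
  linarith

theorem LatticePolygon.subset_of_isLeast {P Q : LatticePolygon} {g h : ℝ → ℝ}
    (hPg : ∀ t, IsLeast (tiltForm (1 : ℤ) t '' P.carrier) (g t))
    (hPh : ∀ t, IsLeast (tiltForm (-1 : ℤ) t '' P.carrier) (h t))
    (hQg : ∀ t, IsLeast (tiltForm (1 : ℤ) t '' Q.carrier) (g t))
    (hQh : ∀ t, IsLeast (tiltForm (-1 : ℤ) t '' Q.carrier) (h t)) : P.carrier ⊆ Q.carrier := by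
  intro x hx
  by_contra hxQ
  obtain ⟨a, b, hb, hsep⟩ := exists_nonvertical_separation Q.convex Q.isCompact hxQ
  rcases lt_or_gt_of_ne hb with hb | hb
  · obtain ⟨y, hy, hyt⟩ := (hQh (a / b)).1
    have h1 := (hPh (a / b)).2 ⟨x, hx, rfl⟩
    rw [← hyt, tiltForm_apply, tiltForm_apply] at h1
    have h2 := mul_le_mul_of_nonneg_left h1 (neg_pos.mpr hb).le
    have h3 := hsep y hy
    have e : ∀ z : Plane, -b * (((-1 : ℤ) : ℝ) * z 1 - a / b * z 0) = a * z 0 + b * z 1 := by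
      intro z
      have := hb.ne
      push_cast
      field_simp
      ring
    rw [e, e] at h2
    linarith
  · obtain ⟨y, hy, hyt⟩ := (hQg (-a / b)).1
    have h1 := (hPg (-a / b)).2 ⟨x, hx, rfl⟩
    rw [← hyt, tiltForm_apply, tiltForm_apply] at h1
    have h2 := mul_le_mul_of_nonneg_left h1 hb.le
    have h3 := hsep y hy
    have e : ∀ z : Plane, b * (((1 : ℤ) : ℝ) * z 1 - -a / b * z 0) = a * z 0 + b * z 1 := by
      intro z
      have := hb.ne'
      push_cast
      field_simp
      ring
    rw [e, e] at h2
    linarith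

/-- The lattice polygons in the closed disc of radius `R`. -/
def polygonsInDisc (R : ℝ) : Set LatticePolygon := {P | P.carrier ⊆ Metric.closedBall (0 : Plane) R}

theorem exists_injOn_polygonsInDisc (R : ℝ) :
    ∃ F : LatticePolygon → ((ℤ × ℤ) × Finset (ℤ × ℤ)) × ((ℤ × ℤ) × Finset (ℤ × ℤ)),
      Set.InjOn F (polygonsInDisc R) ∧ ∀ P ∈ polygonsInDisc R,
        F P ∈ (latticeBox ⌊R⌋₊ ×ˢ edgeSets (8 * ⌊R⌋₊)) ×ˢ
          (latticeBox ⌊R⌋₊ ×ˢ edgeSets (8 * ⌊R⌋₊)) := by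
  have hex : ∀ P : LatticePolygon, ∃ D : ((ℤ × ℤ) × Finset (ℤ × ℤ)) × ((ℤ × ℤ) × Finset (ℤ × ℤ)),
      P ∈ polygonsInDisc R →
        D ∈ (latticeBox ⌊R⌋₊ ×ˢ edgeSets (8 * ⌊R⌋₊)) ×ˢ
          (latticeBox ⌊R⌋₊ ×ˢ edgeSets (8 * ⌊R⌋₊)) ∧
        (∀ t, IsLeast (tiltForm (1 : ℤ) t '' P.carrier) (chainValue D.1.1 D.1.2 t)) ∧
        ∀ t, IsLeast (tiltForm (-1 : ℤ) t '' P.carrier) (chainValue D.2.1 D.2.2 t) := by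
    intro P
    by_cases hP : P ∈ polygonsInDisc R
    · obtain ⟨D₁, hD₁, h₁⟩ := P.exists_chain hP (s := 1) (by simp)
      obtain ⟨D₂, hD₂, h₂⟩ := P.exists_chain hP (s := -1) (by simp)
      exact ⟨(D₁, D₂), fun _ => ⟨Finset.mem_product.mpr ⟨hD₁, hD₂⟩, h₁, h₂⟩⟩
    -- Arbitrary value outside the disc.
    · exact ⟨((0, ∅), (0, ∅)), fun h => absurd h hP⟩
  choose F hF using hex
  refine ⟨F, fun P hP Q hQ hPQ => ?_, fun P hP => (hF P hP).1⟩
  obtain ⟨-, hP1, hP2⟩ := hF P hP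
  obtain ⟨-, hQ1, hQ2⟩ := hF Q hQ
  rw [← hPQ] at hQ1 hQ2
  exact LatticePolygon.ext_carrier (Set.Subset.antisymm
    (LatticePolygon.subset_of_isLeast hP1 hP2 hQ1 hQ2)
    (LatticePolygon.subset_of_isLeast hQ1 hQ2 hP1 hP2))

theorem finite_polygonsInDisc (R : ℝ) : (polygonsInDisc R).Finite := by
  obtain ⟨F, hinj, hmem⟩ := exists_injOn_polygonsInDisc R
  exact Set.Finite.of_finite_image
    ((Finset.finite_toSet _).subset (Set.image_subset_iff.mpr hmem)) hinj

theorem kappa_le (R : ℝ) :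
    kappa R ≤ ((2 * ⌊R⌋₊ + 1) ^ 2 * (edgeSets (8 * ⌊R⌋₊)).card) ^ 2 := by
  obtain ⟨F, hinj, hmem⟩ := exists_injOn_polygonsInDisc R
  refine (Set.ncard_image_le (finite_polygonsInDisc R)).trans ?_
  refine (Set.ncard_le_ncard_of_injOn F hmem hinj (Finset.finite_toSet _)).trans ?_
  rw [Set.ncard_coe_finset, Finset.card_product, Finset.card_product, card_latticeBox]
  exact (sq _).ge

/-! ### Many inequivalent polygons. -/

theorem interior_nonempty_of_triangle_mem {K : Set Plane} (hK : Convex ℝ K) (h0 : latticePoint 0 ∈ K)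
    (h1 : latticePoint ![-1, 0] ∈ K) (h2 : latticePoint ![0, 1] ∈ K) : (interior K).Nonempty := by
  have hopen : IsOpen {x : Plane | x 0 < 0 ∧ 0 < x 1 ∧ x 1 - x 0 < 1} := by
    have h : ∀ i, Continuous fun x : Plane => x i := fun i => by fun_prop
    exact (isOpen_lt (h 0) continuous_const).inter ((isOpen_lt continuous_const (h 1)).inter
      (isOpen_lt ((h 1).sub (h 0)) continuous_const))
  refine ⟨WithLp.toLp 2 ![-1 / 4, 1 / 4], interior_maximal ?_ hopen ?_⟩
  · rintro x ⟨hx0, hx1, hx⟩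
    -- The weights are the barycentric coordinates of `x`.
    have := hK.sum_mem (t := Finset.univ) (w := ![1 + x 0 - x 1, -x 0, x 1])
      (z := ![latticePoint 0, latticePoint ![-1, 0], latticePoint ![0, 1]])
      (by intro i _; fin_cases i <;> simp <;> linarith)
      (by simp [Fin.sum_univ_three]; ring)
      (by intro i _; fin_cases i <;> simpa)
    convert this using 1
    ext i
    fin_cases i <;> simp [Fin.sum_univ_three, latticePoint]
  · simp only [Set.mem_ofPred_eq, Matrix.cons_val_zero, Matrix.cons_val_one]
    norm_num

/-- The vertices of a triangle of area `1 / 2` and the chain points indexed by `S`. -/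
def chainVertices (r : ℕ) (S : Finset (ℕ × ℕ)) : Finset (Fin 2 → ℤ) :=
  {0, ![-1, 0], ![0, 1]} ∪ S.image (chainPoint r)

/-- The polygon spanned by a small triangle and the chain points indexed by `S`. -/
noncomputable def chainPolygon (r : ℕ) (S : Finset (ℕ × ℕ)) : LatticePolygon where
  carrier := convexHull ℝ (latticePoint '' (chainVertices r S : Set (Fin 2 → ℤ)))
  isHull := ⟨_, rfl⟩
  twoDim := by
    refine interior_nonempty_of_triangle_mem (convex_convexHull ℝ _) ?_ ?_ ?_ <;>
    exact subset_convexHull ℝ _ ⟨_, by simp [chainVertices], rfl⟩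

theorem latticePoint_mem_chainPolygon {r : ℕ} {S : Finset (ℕ × ℕ)} {z : Fin 2 → ℤ}
    (hz : z ∈ chainVertices r S) : latticePoint z ∈ (chainPolygon r S).carrier :=
  subset_convexHull ℝ _ ⟨z, hz, rfl⟩

/-- If `u ∉ S`, the form `crossForm u` separates: it is smaller at the other chain points and
nonpositive on the triangle. -/
theorem latticePoint_chainPoint_mem_iff {r : ℕ} (hr : 2 ≤ r) {S : Finset (ℕ × ℕ)}
    (hS : S ⊆ coprimePairs r) {u : ℕ × ℕ} (hu : u ∈ coprimePairs r) :
    latticePoint (chainPoint r u) ∈ (chainPolygon r S).carrier ↔ u ∈ S := by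
  refine ⟨fun h => ?_, fun h => latticePoint_mem_chainPolygon
    (Finset.mem_union_right _ (Finset.mem_image_of_mem _ h))⟩
  by_contra hne
  have hform : ∀ z, -tiltForm u.1 u.2 (latticePoint z) = crossForm u z := by
    intro z
    simp [tiltForm_apply, crossForm, latticePoint]
  have hup := mem_pairs.mp (mem_coprimePairs.mp hu).1
  have hpos := crossForm_chainPoint_pos hr (mem_coprimePairs.mp hu).1
  have hsub : (chainPolygon r S).carrier ⊆
      {x | -(crossForm u (chainPoint r u) : ℝ) < tiltForm u.1 u.2 x} := by
    refine convexHull_min ?_ (convex_halfSpace_gt (tiltForm u.1 u.2).isLinear _)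
    rintro _ ⟨z, hz, rfl⟩
    rw [Set.mem_ofPred_eq, neg_lt, hform]
    norm_cast
    simp only [chainVertices, Finset.coe_union, Finset.coe_image, Set.mem_union, Finset.mem_coe,
      Finset.mem_insert, Finset.mem_singleton, Set.mem_image] at hz
    rcases hz with (rfl | rfl | rfl) | ⟨w, hw, rfl⟩
    · simpa [crossForm] using hpos
    · refine lt_of_le_of_lt ?_ hpos
      simp [crossForm]
    · refine lt_of_le_of_lt ?_ hpos
      simp [crossForm]
    · exact crossForm_chainPoint_lt hu (hS hw) (fun h => hne (h ▸ hw))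
  have := hsub h
  rw [Set.mem_ofPred_eq, ← hform, neg_neg] at this
  exact lt_irrefl _ this

theorem chainPolygon_injective {r : ℕ} (hr : 2 ≤ r) {S T : Finset (ℕ × ℕ)} (hS : S ⊆ coprimePairs r)
    (hT : T ⊆ coprimePairs r) (h : chainPolygon r S = chainPolygon r T) : S = T := by
  ext u
  by_cases hu : u ∈ coprimePairs r
  · rw [← latticePoint_chainPoint_mem_iff hr hS hu, h, latticePoint_chainPoint_mem_iff hr hT hu]
  · exact ⟨fun h => absurd (hS h) hu, fun h => absurd (hT h) hu⟩

theorem norm_latticePoint_le {z : Fin 2 → ℤ} {k : ℕ} (hz : ∀ i, |z i| ≤ (k : ℤ)) :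
    ‖latticePoint z‖ ≤ 2 * k := by
  rw [EuclideanSpace.norm_eq, Real.sqrt_le_left (by positivity)]
  have h : ∀ i, (z i : ℝ) ^ 2 ≤ (k : ℝ) ^ 2 := fun i => by
    rw [sq_le_sq, Nat.abs_cast]
    exact_mod_cast hz i
  simp only [latticePoint, Real.norm_eq_abs, sq_abs, Fin.sum_univ_two]
  nlinarith [h 0, h 1, sq_nonneg (k : ℝ)]

theorem chainPolygon_mem_polygonsInDisc {r : ℕ} (hr : 1 ≤ r) {R : ℝ} (hR : 2 * (r : ℝ) ^ 3 ≤ R)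
    (S : Finset (ℕ × ℕ)) : chainPolygon r S ∈ polygonsInDisc R := by
  refine convexHull_min ?_ (convex_closedBall 0 R)
  rintro _ ⟨z, hz, rfl⟩
  rw [mem_closedBall_zero_iff]
  have hr1 : (1 : ℤ) ≤ (r : ℤ) ^ 3 := one_le_pow₀ (by exact_mod_cast hr)
  refine (norm_latticePoint_le (k := r ^ 3) ?_).trans (by exact_mod_cast hR)
  intro i
  push_cast
  simp only [chainVertices, Finset.coe_union, Finset.coe_image, Set.mem_union, Finset.mem_coe,
    Finset.mem_insert, Finset.mem_singleton, Set.mem_image] at hz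
  rcases hz with (rfl | rfl | rfl) | ⟨w, -, rfl⟩
  · simp
  · fin_cases i <;> simp [hr1]
  · fin_cases i <;> simp [hr1]
  · exact abs_chainPoint_le r w i

/-- The integer matrices and vectors all of whose entries are bounded by `m`. -/
noncomputable def boundedAffineMaps (m : ℕ) : Finset ((Fin 2 → Fin 2 → ℤ) × (Fin 2 → ℤ)) :=
  Fintype.piFinset (fun _ => Fintype.piFinset fun _ => Finset.Icc (-m : ℤ) m) ×ˢ
    Fintype.piFinset fun _ => Finset.Icc (-m : ℤ) m

theorem card_boundedAffineMaps (m : ℕ) : (boundedAffineMaps m).card = (2 * m + 1) ^ 6 := by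
  have : (Finset.Icc (-m : ℤ) m).card = 2 * m + 1 := by rw [Int.card_Icc]; omega
  simp only [boundedAffineMaps, Finset.card_product, Fintype.card_piFinset, this,
    Finset.prod_const, Finset.card_univ, Fintype.card_fin]
  ring

/-- Up to sign, the columns of `A` are differences of images of triangle vertices, which lie in the
disc; hence the bound `2 * R`. -/
theorem mem_boundedAffineMaps {P Q : LatticePolygon} {R : ℝ} (hQ : Q ∈ polygonsInDisc R)
    (h0 : latticePoint 0 ∈ P.carrier) (h1 : latticePoint ![-1, 0] ∈ P.carrier)
    (h2 : latticePoint ![0, 1] ∈ P.carrier) {A : GL (Fin 2) ℤ} {b : Fin 2 → ℤ}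
    (h : unimodularMap A b '' P.carrier = Q.carrier) :
    ((fun i j => (A : Matrix (Fin 2) (Fin 2) ℤ) i j), b) ∈ boundedAffineMaps ⌊2 * R⌋₊ := by
  have hbd : ∀ z, latticePoint z ∈ P.carrier → ∀ i,
      |unimodularMap A b (latticePoint z) i| ≤ R := by
    intro z hz i
    refine (abs_coord_le_norm _ i).trans ?_
    have := hQ (h ▸ Set.mem_image_of_mem _ hz)
    rwa [mem_closedBall_zero_iff] at this
  have hb : ∀ i, |(b i : ℝ)| ≤ R := fun i => by
    have := hbd _ h0 i
    fin_cases i <;>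
    simpa [unimodularMap, latticePoint, Matrix.mulVec, dotProduct, Fin.sum_univ_two] using this
  have hA0 : ∀ i, |-((A : Matrix (Fin 2) (Fin 2) ℤ) i 0 : ℝ) + b i| ≤ R := fun i => by
    have := hbd _ h1 i
    fin_cases i <;>
    simpa [unimodularMap, latticePoint, Matrix.mulVec, dotProduct, Fin.sum_univ_two] using this
  have hA1 : ∀ i, |((A : Matrix (Fin 2) (Fin 2) ℤ) i 1 : ℝ) + b i| ≤ R := fun i => by
    have := hbd _ h2 i
    fin_cases i <;>
    simpa [unimodularMap, latticePoint, Matrix.mulVec, dotProduct, Fin.sum_univ_two] using this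
  have hint : ∀ n : ℤ, |(n : ℝ)| ≤ 2 * R → n ∈ Finset.Icc (-(⌊2 * R⌋₊ : ℤ)) ⌊2 * R⌋₊ := by
    intro n hn
    have h' : (n.natAbs : ℝ) ≤ 2 * R := by rwa [Nat.cast_natAbs, Int.cast_abs]
    have := Nat.le_floor h'
    rw [Finset.mem_Icc]
    omega
  rw [boundedAffineMaps, Finset.mem_product]
  have hb' := fun i => abs_le.mp (hb i)
  have hA0' := fun i => abs_le.mp (hA0 i)
  have hA1' := fun i => abs_le.mp (hA1 i)
  refine ⟨Fintype.mem_piFinset.mpr fun i => Fintype.mem_piFinset.mpr fun j =>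
    hint _ (abs_le.mpr ?_), Fintype.mem_piFinset.mpr fun i => hint _ (abs_le.mpr ?_)⟩
  · have := hb' i
    have := hA0' i
    have := hA1' i
    fin_cases j <;> constructor <;> simp only [Fin.zero_eta, Fin.mk_one] <;> linarith
  · have := hb' i
    constructor <;> linarith

theorem two_pow_card_le_kappa {r : ℕ} (hr : 2 ≤ r) {R : ℝ} (hR : 2 * (r : ℝ) ^ 3 ≤ R) :
    2 ^ (coprimePairs r).card ≤ (2 * ⌊2 * R⌋₊ + 1) ^ 6 * kappa R := by
  classical
  set f : Finset (ℕ × ℕ) → Quotient unimodularSetoid :=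
    fun S => Quotient.mk unimodularSetoid (chainPolygon r S) with hf
  rw [← Finset.card_powerset]
  refine (Finset.card_le_mul_card_image (f := f) _ ((2 * ⌊2 * R⌋₊ + 1) ^ 6) ?_).trans ?_
  · intro c hc
    obtain ⟨S₀, -, rfl⟩ := Finset.mem_image.mp hc
    -- Within one class, the map from the fixed polygon of `S₀` determines `S`.
    have hex : ∀ S, ∃ D : GL (Fin 2) ℤ × (Fin 2 → ℤ), f S = f S₀ →
        unimodularMap D.1 D.2 '' (chainPolygon r S₀).carrier = (chainPolygon r S).carrier := by
      intro S
      by_cases h : f S = f S₀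
      · obtain ⟨A, b, hAb⟩ : UnimodularEquiv (chainPolygon r S₀) (chainPolygon r S) :=
          Quotient.exact h.symm
        exact ⟨(A, b), fun _ => hAb⟩
      · exact ⟨(1, 0), fun h' => absurd h' h⟩
    choose D hD using hex
    rw [← card_boundedAffineMaps]
    refine Finset.card_le_card_of_injOn (fun S =>
      ((fun i j => ((D S).1 : Matrix (Fin 2) (Fin 2) ℤ) i j), (D S).2)) ?_ ?_
    · intro S hS
      have hS' := (Finset.mem_filter.mp hS).2
      refine mem_boundedAffineMaps (chainPolygon_mem_polygonsInDisc (by omega) hR S)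
        ?_ ?_ ?_ (hD S hS') <;>
      exact latticePoint_mem_chainPolygon (by simp [chainVertices])
    · intro S hS T hT hST
      obtain ⟨hS1, hS2⟩ := Finset.mem_filter.mp hS
      obtain ⟨hT1, hT2⟩ := Finset.mem_filter.mp hT
      have h1 : (D S).1 = (D T).1 := Units.ext (Prod.ext_iff.mp hST).1
      have h2 : (D S).2 = (D T).2 := (Prod.ext_iff.mp hST).2
      refine chainPolygon_injective hr (Finset.mem_powerset.mp hS1) (Finset.mem_powerset.mp hT1)
        (LatticePolygon.ext_carrier ?_)
      rw [← hD S hS2, ← hD T hT2, h1, h2]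
  · gcongr
    rw [← Set.ncard_coe_finset]
    refine Set.ncard_le_ncard ?_ ((finite_polygonsInDisc R).image _)
    intro c hc
    obtain ⟨S, -, rfl⟩ := Finset.mem_image.mp (Finset.mem_coe.mp hc)
    exact ⟨_, chainPolygon_mem_polygonsInDisc (by omega) hR S, rfl⟩

/-! ### Logarithmic estimates with `R = y ^ 3`. -/

theorem log_kappa_le {y : ℝ} (hy : 1 ≤ y) :
    Real.log (kappa (y ^ 3) : ℝ) ≤ 92 * y ^ 2 := by
  rcases Nat.eq_zero_or_pos (kappa (y ^ 3)) with h0 | h0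
  · rw [h0, Nat.cast_zero, Real.log_zero]
    positivity
  have hy0 : 0 < y := by linarith
  have hy3 : 1 ≤ y ^ 3 := one_le_pow₀ hy
  obtain ⟨m, hm⟩ : ∃ m, m = ⌊y ^ 3⌋₊ := ⟨_, rfl⟩
  have hmle : (m : ℝ) ≤ y ^ 3 := hm ▸ Nat.floor_le (by positivity)
  have hm1 : 1 ≤ m := hm ▸ Nat.le_floor (by simpa using hy3)
  have hk : (kappa (y ^ 3) : ℝ) ≤ ((2 * m + 1) ^ 2 * (edgeSets (8 * m)).card) ^ 2 := by
    have h := kappa_le (y ^ 3)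
    rw [← hm] at h
    exact_mod_cast h
  have hpow : ((8 * m : ℕ) : ℝ) ^ (2 / 3 : ℝ) ≤ 4 * y ^ 2 := by
    calc ((8 * m : ℕ) : ℝ) ^ (2 / 3 : ℝ) ≤ ((2 * y) ^ (3 : ℝ)) ^ (2 / 3 : ℝ) := by
          gcongr
          push_cast
          rw [show (3 : ℝ) = ((3 : ℕ) : ℝ) by norm_num, Real.rpow_natCast]
          nlinarith
      _ = 4 * y ^ 2 := by
          rw [← Real.rpow_mul (by positivity), show (3 * (2 / 3) : ℝ) = ((2 : ℕ) : ℝ) by norm_num,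
            Real.rpow_natCast]
          ring
  have hE : ((edgeSets (8 * m)).card : ℝ) ≤ Real.exp (36 * y ^ 2) :=
    (card_edgeSets_le (by omega)).trans (Real.exp_le_exp.mpr (by linarith))
  have h3 : (2 * m + 1 : ℝ) ≤ 3 * y ^ 3 := by linarith
  have hk' : (kappa (y ^ 3) : ℝ) ≤ ((3 * y ^ 3) ^ 2 * Real.exp (36 * y ^ 2)) ^ 2 :=
    hk.trans (by gcongr)
  have hlog := Real.log_le_log (by exact_mod_cast h0) hk'
  rw [Real.log_pow, Real.log_mul (by positivity) (by positivity), Real.log_pow, Real.log_exp,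
    Real.log_mul (by norm_num) (by positivity), Real.log_pow] at hlog
  push_cast at hlog
  have h4 := Real.log_le_sub_one_of_pos (show (0 : ℝ) < 3 by norm_num)
  have h5 := Real.log_le_sub_one_of_pos hy0
  -- The bound is `72 y² + 4 log 3 + 12 log y`, and the logarithms cost at most `12 y - 4`.
  nlinarith

theorem le_log_kappa {y : ℝ} (hy : 12000 ≤ y) :
    1 / 1000 * y ^ 2 ≤ Real.log (kappa (y ^ 3) : ℝ) := by
  have hy0 : 0 < y := by linarith
  have hy3 : 1 ≤ y ^ 3 := one_le_pow₀ (by linarith)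
  obtain ⟨r, hr⟩ : ∃ r, r = ⌊y / 2⌋₊ := ⟨_, rfl⟩
  have hrle : (r : ℝ) ≤ y / 2 := hr ▸ Nat.floor_le (by positivity)
  have hrge : y / 3 ≤ r := by
    have := Nat.lt_floor_add_one (y / 2)
    rw [← hr] at this
    linarith
  have hr2 : 2 ≤ r := by
    have : (2 : ℝ) ≤ r := by linarith
    exact_mod_cast this
  have hR : 2 * (r : ℝ) ^ 3 ≤ y ^ 3 := by
    have : (r : ℝ) ^ 3 ≤ (y / 2) ^ 3 := by gcongr
    have : 0 < y ^ 3 := by positivity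
    linarith [show (y / 2) ^ 3 = y ^ 3 / 8 by ring]
  have hk : (2 : ℝ) ^ (coprimePairs r).card
      ≤ (2 * (⌊2 * y ^ 3⌋₊ : ℝ) + 1) ^ 6 * kappa (y ^ 3) := by
    exact_mod_cast two_pow_card_le_kappa hr2 hR
  have hfl : (⌊2 * y ^ 3⌋₊ : ℝ) ≤ 2 * y ^ 3 := Nat.floor_le (by positivity)
  have hk0 : 0 < (kappa (y ^ 3) : ℝ) := by
    have := (show (0 : ℝ) < 2 ^ (coprimePairs r).card by positivity).trans_le hk
    exact pos_of_mul_pos_right this (by positivity)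
  have hk' : (2 : ℝ) ^ (coprimePairs r).card ≤ (5 * y ^ 3) ^ 6 * kappa (y ^ 3) :=
    hk.trans (by gcongr; linarith)
  have hlog := Real.log_le_log (by positivity) hk'
  rw [Real.log_pow, Real.log_mul (by positivity) hk0.ne', Real.log_pow,
    Real.log_mul (by norm_num) (by positivity), Real.log_pow] at hlog
  push_cast at hlog
  have h4 := Real.log_le_sub_one_of_pos (show (0 : ℝ) < 5 by norm_num)
  have h5 := Real.log_le_sub_one_of_pos hy0
  have h6 : y ^ 2 / 36 ≤ (coprimePairs r).card := by
    have h7 : (r : ℝ) ^ 2 ≤ 4 * (coprimePairs r).card := by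
      exact_mod_cast sq_le_four_mul_card_coprimePairs hr2
    have h8 : (y / 3) ^ 2 ≤ (r : ℝ) ^ 2 := by gcongr
    linarith [show (y / 3) ^ 2 = y ^ 2 / 9 by ring]
  have h9 : y ^ 2 / 36 * (1 / 2) ≤ (coprimePairs r).card * Real.log 2 := by
    have := Real.log_two_gt_d9
    gcongr
    linarith
  -- The polynomial factor costs at most `18 y + 6`, absorbed by `y² / 72 - y² / 1000` for such
  -- large `y`.
  nlinarith

theorem theorem2p1 :
    ∃ c₁ c₂ : ℝ, 0 < c₁ ∧ 0 < c₂ ∧ ∃ R₀ : ℝ, ∀ R : ℝ, R₀ ≤ R →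
      c₁ * R ^ (2 / 3 : ℝ) ≤ Real.log (kappa R : ℝ) ∧
        Real.log (kappa R : ℝ) ≤ c₂ * R ^ (2 / 3 : ℝ) := by
  refine ⟨1 / 1000, 92, by norm_num, by norm_num, 12000 ^ 3, fun R hR => ?_⟩
  have hR0 : 0 ≤ R := le_trans (by norm_num) hR
  obtain ⟨y, hy⟩ : ∃ y, y = R ^ (1 / 3 : ℝ) := ⟨_, rfl⟩
  have hy0 : 0 ≤ y := hy ▸ Real.rpow_nonneg hR0 _
  have hy3 : y ^ 3 = R := by
    rw [hy, ← Real.rpow_natCast, ← Real.rpow_mul hR0]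
    norm_num
  have hy2 : R ^ (2 / 3 : ℝ) = y ^ 2 := by
    rw [hy, ← Real.rpow_natCast, ← Real.rpow_mul hR0]
    norm_num
  have hyge : 12000 ≤ y := by
    rw [← hy3] at hR
    exact le_of_pow_le_pow_left₀ (by norm_num) hy0 hR
  rw [hy2, ← hy3]
  exact ⟨le_log_kappa hyge, log_kappa_le (by linarith)⟩
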